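/- An $\mathbb{R}$-tree is a nonempty metric space $X$ in which any two points are joined by a unique geodesic segment (an isometric copy of a compact real interval), and in which the union of two geodesic segments that meet exactly in one common endpoint is again a geodesic segment. Let a group $G$ act by isometries on $X$. The translation length of $g\in G$ is $\ell_X(g)=\inf_{x\in X} d(x,gx)$, and the action has trivial arc stabilizers if no nontrivial element of $G$ fixes a nondegenerate geodesic segment pointwise. Let $G$ be a nonabelian group. (1) Suppose that the abelianization of $G$ contains an element of infinite order. Then for every integer $M\ge 1$ there exist nontrivial elements $g_1,\dots,g_M\in G$ such that, for $i\neq j$, $g_i$ is conjugate neither to $g_j$ nor to $g_j^{-1}$, and such that for every isometric action of $G$ with trivial arc stabilizers on an $\mathbb{R}$-tree $X$ we have $\ell_X(g_i)=\ell_X(g_j)$ for all $i,j$. (2) Suppose that the abelianization of $G$ contains an element of order greater than four (possibly of infinite order). Then there exist nontrivial elements $g_1,g_2\in G$ such that $g_1$ is conjugate neither to $g_2$ nor to $g_2^{-1}$, and such that for every isometric action of $G$ with trivial arc stabilizers on an $\mathbb{R}$-tree $X$ we have $\ell_X(g_1)=\ell_X(g_2)$. -/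

import Mathlib

universe u v

/-- `S` is a geodesic segment from `x` to `y`: the image of the real interval `[0, dist x y]`
under a distance-preserving map which sends the endpoints to `x` and `y`. -/
def IsGeodesicSegment {X : Type v} [MetricSpace X] (x y : X) (S : Set X) : Prop :=
  ∃ γ : ℝ → X, γ 0 = x ∧ γ (dist x y) = y ∧
    (∀ s ∈ Set.Icc (0 : ℝ) (dist x y), ∀ t ∈ Set.Icc (0 : ℝ) (dist x y),
      dist (γ s) (γ t) = |s - t|) ∧
    S = γ '' Set.Icc (0 : ℝ) (dist x y)

/-- An `ℝ`-tree: a nonempty metric space in which any two points are joined by a unique geodesic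
segment, and in which two segments that meet only in a common endpoint have a segment as union. -/
structure IsRTree (X : Type v) [MetricSpace X] : Prop where
  nonempty : Nonempty X
  existsUnique_segment : ∀ x y : X, ∃! S : Set X, IsGeodesicSegment x y S
  segment_union : ∀ (x y z : X) (S T : Set X), IsGeodesicSegment x y S → IsGeodesicSegment y z T →
    S ∩ T = {y} → IsGeodesicSegment x z (S ∪ T)

/-- The action of `G` on `X` has trivial arc stabilizers: only the identity of `G` fixes a
nondegenerate geodesic segment pointwise. -/
def HasTrivialArcStabilizers (G : Type u) [Group G] (X : Type v) [MetricSpace X]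
    [MulAction G X] : Prop :=
  ∀ (x y : X) (S : Set X), x ≠ y → IsGeodesicSegment x y S → fixingSubgroup G S = ⊥

/-- The translation length `ℓ_X(g)`, the infimum of `dist x (g • x)` over all `x` in `X`. -/
noncomputable def translationLength {G : Type u} [Group G] (X : Type v) [MetricSpace X]
    [MulAction G X] (g : G) : ℝ :=
  ⨅ x : X, dist x (g • x)

/-- `g` and `h` have the same translation length in every isometric action of `G`, with trivial
arc stabilizers, on an `ℝ`-tree. -/
def EqualTranslationLengths {G : Type u} [Group G] (g h : G) : Prop :=
  ∀ (X : Type v) [MetricSpace X] [MulAction G X] [IsIsometricSMul G X],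
    IsRTree X → HasTrivialArcStabilizers G X → translationLength X g = translationLength X h

/-! Choose a noncentral `a`, some `b` not commuting with it, and put `c = b * a * b⁻¹`. The elements
used are `a ^ p` times the conjugate of `a ^ r` by `c ^ 2`. The abelianization sees `p + r`, while
translation lengths see only `|p| + |r|`, so changing exponents and signs separates conjugacy
classes without changing lengths.

If `a` fixes a point, both nontrivial factors are elliptic and the length is twice the distance
between their fixed points, whatever the exponents. Otherwise `a` and its conjugate by `c ^ 2` have
disjoint axes: a common point would make `a` or `a⁻¹` agree with `c` on an arc
(`eq_or_eq_inv_of_onAxis`), forcing `c = a` or `c = a⁻¹`, which noncommutation and the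
abelianization exclude. The length is then `(|p| + |r|) * l + D`, with `D` twice the distance
between the axes (`exists_translationLength_mul_conj`). All tree geometry is reduced to the four
point condition and linear arithmetic in distances. -/

/-! ### Zero-hyperbolic metric spaces -/

/-- The four point condition characterising `0`-hyperbolic metric spaces. -/
def FourPoint (X : Type v) [MetricSpace X] : Prop :=
  ∀ x y z w : X, dist x y + dist z w ≤ max (dist x z + dist y w) (dist x w + dist y z)

/-- `y` lies metrically between `x` and `z`. -/
def MBtw {X : Type v} [MetricSpace X] (x y z : X) : Prop :=
  dist x y + dist y z = dist x z

/-- Every distance is realised by points in between. -/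
def HasBetweenPoints (X : Type v) [MetricSpace X] : Prop :=
  ∀ (x y : X) (t : ℝ), 0 ≤ t → t ≤ dist x y → ∃ p, dist x p = t ∧ dist p y = dist x y - t

theorem FourPoint.or {X : Type v} [MetricSpace X] (h4 : FourPoint X) (x y z w : X) :
    dist x y + dist z w ≤ dist x z + dist y w ∨ dist x y + dist z w ≤ dist x w + dist y z :=
  le_max_iff.1 (h4 x y z w)

theorem IsGeodesicSegment.mbtw {X : Type v} [MetricSpace X] {x y p : X} {S : Set X}
    (h : IsGeodesicSegment x y S) (hp : p ∈ S) : MBtw x p y := by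
  obtain ⟨γ, h0, h1, hd, rfl⟩ := h
  obtain ⟨t, ht, rfl⟩ := hp
  have e1 := hd 0 ⟨le_rfl, dist_nonneg⟩ t ht
  have e2 := hd t ht (dist x y) ⟨dist_nonneg, le_rfl⟩
  rw [h0, abs_of_nonpos (by linarith [ht.1])] at e1
  rw [h1, abs_of_nonpos (by linarith [ht.2])] at e2
  unfold MBtw
  linarith

theorem IsRTree.hasBetweenPoints {X : Type v} [MetricSpace X] (hX : IsRTree X) :
    HasBetweenPoints X := by
  intro x y t ht0 ht1
  obtain ⟨S, ⟨γ, h0, h1, hd, -⟩, -⟩ := hX.existsUnique_segment x y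
  refine ⟨γ t, ?_, ?_⟩
  · have e1 := hd 0 ⟨le_rfl, dist_nonneg⟩ t ⟨ht0, ht1⟩
    rw [h0, abs_of_nonpos (by linarith)] at e1
    linarith
  · have e2 := hd t ⟨ht0, ht1⟩ (dist x y) ⟨dist_nonneg, le_rfl⟩
    rw [h1, abs_of_nonpos (by linarith)] at e2
    linarith

/-- The final part of a segment is a segment, which ends where the whole segment ends. -/
theorem isGeodesicSegment_tail {X : Type v} [MetricSpace X] {x y : X} {γ : ℝ → X}
    (h1 : γ (dist x y) = y)
    (hd : ∀ s ∈ Set.Icc (0 : ℝ) (dist x y), ∀ t ∈ Set.Icc (0 : ℝ) (dist x y),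
      dist (γ s) (γ t) = |s - t|) {t : ℝ} (ht : t ∈ Set.Icc (0 : ℝ) (dist x y)) :
    IsGeodesicSegment (γ t) y (γ '' Set.Icc t (dist x y)) := by
  have e2 := hd t ht (dist x y) ⟨dist_nonneg, le_rfl⟩
  rw [h1, abs_of_nonpos (by linarith [ht.2])] at e2
  refine ⟨fun s => γ (t + s), by simp, ?_, ?_, ?_⟩
  · simp only [e2]
    rw [← h1]
    congr 1
    rw [h1]
    ring
  · intro s hs u hu
    rw [e2] at hs hu
    rw [hd _ ⟨by linarith [hs.1, ht.1], by linarith [hs.2]⟩ _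
      ⟨by linarith [hu.1, ht.1], by linarith [hu.2]⟩]
    congr 1
    ring
  · rw [e2]
    ext p
    constructor
    · rintro ⟨s, hs, rfl⟩
      exact ⟨s - t, ⟨by linarith [hs.1], by linarith [hs.2]⟩, by simp⟩
    · rintro ⟨s, hs, rfl⟩
      exact ⟨t + s, ⟨by linarith [hs.1], by linarith [hs.2]⟩, rfl⟩

theorem IsGeodesicSegment.symm {X : Type v} [MetricSpace X] {x y : X} {S : Set X}
    (h : IsGeodesicSegment x y S) : IsGeodesicSegment y x S := by
  obtain ⟨γ, h0, h1, hd, rfl⟩ := h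
  refine ⟨fun s => γ (dist x y - s), by simpa using h1, by simpa [dist_comm y x] using h0, ?_, ?_⟩
  · intro s hs t ht
    rw [dist_comm y x] at hs ht
    rw [hd _ ⟨by linarith [hs.2], by linarith [hs.1]⟩ _ ⟨by linarith [ht.2], by linarith [ht.1]⟩,
      abs_sub_comm]
    congr 1
    ring
  · rw [dist_comm y x]
    ext p
    constructor
    · rintro ⟨s, hs, rfl⟩
      exact ⟨dist x y - s, ⟨by linarith [hs.2], by linarith [hs.1]⟩, by simp⟩
    · rintro ⟨s, hs, rfl⟩
      exact ⟨dist x y - s, ⟨by linarith [hs.2], by linarith [hs.1]⟩, rfl⟩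

/-- Two segments with a common starting point branch at a point between their other endpoints. -/
theorem IsRTree.exists_branch_point {X : Type v} [MetricSpace X] (hX : IsRTree X) {x y z : X}
    {S T : Set X} (hS : IsGeodesicSegment x y S) (hT : IsGeodesicSegment x z T) :
    ∃ c ∈ S ∩ T, MBtw y c z := by
  obtain ⟨γ, g0, g1, gd, rfl⟩ := hS
  obtain ⟨δ, d0, d1, dd, rfl⟩ := hT
  set A : Set ℝ := {t | t ∈ Set.Icc (0 : ℝ) (min (dist x y) (dist x z)) ∧ γ t = δ t} with hA
  have hm : 0 ≤ min (dist x y) (dist x z) := le_min dist_nonneg dist_nonneg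
  have hsub1 : Set.Icc (0 : ℝ) (min (dist x y) (dist x z)) ⊆ Set.Icc 0 (dist x y) :=
    Set.Icc_subset_Icc_right (min_le_left _ _)
  have hsub2 : Set.Icc (0 : ℝ) (min (dist x y) (dist x z)) ⊆ Set.Icc 0 (dist x z) :=
    Set.Icc_subset_Icc_right (min_le_right _ _)
  have h0A : (0 : ℝ) ∈ A := ⟨⟨le_rfl, hm⟩, g0.trans d0.symm⟩
  have hbdd : BddAbove A := ⟨_, fun t ht => ht.1.2⟩
  set c := sSup A with hc
  have hcI : c ∈ Set.Icc (0 : ℝ) (min (dist x y) (dist x z)) :=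
    ⟨le_csSup hbdd h0A, csSup_le ⟨0, h0A⟩ fun t ht => ht.1.2⟩
  have hcA : γ c = δ c := by
    refine dist_le_zero.1 (le_of_forall_pos_le_add fun ε hε => ?_)
    obtain ⟨t, ht, hlt⟩ := exists_lt_of_lt_csSup ⟨0, h0A⟩ (show c - ε / 2 < c by linarith)
    have htc : t ≤ c := le_csSup hbdd ht
    have e1 := gd c (hsub1 hcI) t (hsub1 ht.1)
    have e2 := dd t (hsub2 ht.1) c (hsub2 hcI)
    rw [abs_of_nonneg (by linarith)] at e1
    rw [abs_of_nonpos (by linarith), ← ht.2] at e2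
    linarith [dist_triangle (γ c) (γ t) (δ c)]
  have s1 := isGeodesicSegment_tail g1 gd (hsub1 hcI)
  have s2 := isGeodesicSegment_tail d1 dd (hsub2 hcI)
  rw [← hcA] at s2
  refine ⟨γ c, ⟨⟨c, hsub1 hcI, rfl⟩, ⟨c, hsub2 hcI, hcA.symm⟩⟩, ?_⟩
  -- A common point of the two tails has the same parameter on both, namely its distance to `x`, so
  -- maximality of `c` leaves only `γ c`.
  refine (hX.segment_union _ _ _ _ _ s1.symm s2 ?_).mbtw
    (Or.inl ⟨c, ⟨le_rfl, (hsub1 hcI).2⟩, rfl⟩)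
  ext p
  constructor
  · rintro ⟨⟨s, hs, rfl⟩, ⟨t, ht, hst⟩⟩
    have hs' : s ∈ Set.Icc (0 : ℝ) (dist x y) := ⟨hcI.1.trans hs.1, hs.2⟩
    have ht' : t ∈ Set.Icc (0 : ℝ) (dist x z) := ⟨hcI.1.trans ht.1, ht.2⟩
    have e1 := gd 0 ⟨le_rfl, dist_nonneg⟩ s hs'
    have e2 := dd 0 ⟨le_rfl, dist_nonneg⟩ t ht'
    rw [g0, abs_of_nonpos (by linarith [hs'.1])] at e1
    rw [d0, hst, abs_of_nonpos (by linarith [ht'.1])] at e2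
    have hst' : t = s := by linarith
    subst hst'
    have : t ≤ c := le_csSup hbdd ⟨⟨hs'.1, le_min hs'.2 ht'.2⟩, hst.symm⟩
    have : t = c := le_antisymm this hs.1
    simp [this]
  · rintro rfl
    exact ⟨⟨c, ⟨le_rfl, (hsub1 hcI).2⟩, rfl⟩, ⟨c, ⟨le_rfl, (hsub2 hcI).2⟩, hcA.symm⟩⟩

theorem IsGeodesicSegment.mbtw_of_dist_le {X : Type v} [MetricSpace X] {x y p q : X} {S : Set X}
    (h : IsGeodesicSegment x y S) (hp : p ∈ S) (hq : q ∈ S) (hle : dist x p ≤ dist x q) :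
    MBtw x p q := by
  obtain ⟨γ, h0, -, hd, rfl⟩ := h
  obtain ⟨s, hs, rfl⟩ := hp
  obtain ⟨t, ht, rfl⟩ := hq
  have e1 := hd 0 ⟨le_rfl, dist_nonneg⟩ s hs
  have e2 := hd 0 ⟨le_rfl, dist_nonneg⟩ t ht
  rw [h0, abs_of_nonpos (by linarith [hs.1])] at e1
  rw [h0, abs_of_nonpos (by linarith [ht.1])] at e2
  have e3 := hd s hs t ht
  rw [abs_of_nonpos (by linarith)] at e3
  unfold MBtw
  linarith

/-- The branch points `c` of `x, z` and `e` of `z, y`, as seen from `w`, both lie on the segment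
from `w` to `z`; their order there decides which alternative holds. -/
theorem IsRTree.fourPoint {X : Type v} [MetricSpace X] (hX : IsRTree X) : FourPoint X := by
  intro x y z w
  obtain ⟨Sx, hSx, -⟩ := hX.existsUnique_segment w x
  obtain ⟨Sz, hSz, -⟩ := hX.existsUnique_segment w z
  obtain ⟨Sy, hSy, -⟩ := hX.existsUnique_segment w y
  obtain ⟨c, hc, bc⟩ := hX.exists_branch_point hSx hSz
  obtain ⟨e, he, be⟩ := hX.exists_branch_point hSz hSy
  have c1 := hSx.mbtw hc.1
  have c2 := hSz.mbtw hc.2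
  have e1 := hSz.mbtw he.1
  have e2 := hSy.mbtw he.2
  simp only [MBtw] at *
  rw [le_max_iff]
  rw [dist_comm w x, dist_comm c x] at c1
  rw [dist_comm w z] at c2 e1
  rw [dist_comm w y] at e2
  rw [dist_comm z e, dist_comm z y] at be
  rcases le_total (dist w c) (dist w e) with hle | hle
  · have f := hSz.mbtw_of_dist_le hc.2 he.1 hle
    simp only [MBtw] at f
    left
    linarith [dist_triangle x c y, dist_triangle c e y, dist_comm x c]
  · have f := hSz.mbtw_of_dist_le he.1 hc.2 hle
    simp only [MBtw] at f
    right
    linarith [dist_triangle x e y, dist_triangle x c e, dist_comm x c, dist_comm e c]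

/-! ### Betweenness -/

section Between

variable {X : Type v} [MetricSpace X]

theorem MBtw.symm {x y z : X} (h : MBtw x y z) : MBtw z y x := by
  unfold MBtw at *
  linarith [dist_comm x y, dist_comm y z, dist_comm x z]

theorem MBtw.smul {G : Type u} [Group G] [MulAction G X] [IsIsometricSMul G X] {x y z : X}
    (h : MBtw x y z) (g : G) : MBtw (g • x) (g • y) (g • z) := by
  simpa only [MBtw, dist_smul] using h

/-- If `y` is between `x`, `z` and `p` is between `x`, `y`, then `y` is between `p`, `z`. -/
theorem MBtw.right_of_left {x p y z : X} (h : MBtw x y z) (hp : MBtw x p y) : MBtw p y z := by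
  unfold MBtw at *
  linarith [dist_triangle x p z, dist_triangle p y z]

theorem MBtw.trans_left {x p y z : X} (h : MBtw x y z) (hp : MBtw x p y) : MBtw x p z := by
  unfold MBtw at *
  linarith [dist_triangle x p z, dist_triangle p y z]

/-- Local geodesics are global. The overlap from `y` to `z` must be nondegenerate, since otherwise
the path may backtrack. -/
theorem FourPoint.concat (h4 : FourPoint X) {x y z w : X} (h1 : MBtw x y z) (h2 : MBtw y z w)
    (hne : y ≠ z) : MBtw x y w ∧ MBtw x z w := by
  have hpos := dist_pos.2 hne
  unfold MBtw at *
  have ht := dist_triangle x y w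
  rcases h4.or x z y w with h | h
  · linarith [dist_comm z w, dist_comm x y]
  · constructor <;> linarith [dist_comm z y]

theorem FourPoint.eq_of_mbtw (h4 : FourPoint X) {x y p q : X} (hp : MBtw x p y) (hq : MBtw x q y)
    (h : dist x p = dist x q) : p = q := by
  unfold MBtw at *
  refine dist_le_zero.1 ?_
  rcases h4.or x y p q with h' | h' <;> linarith [dist_comm p y, dist_comm q y]

theorem FourPoint.fixes_of_mbtw {G : Type u} [Group G] [MulAction G X] [IsIsometricSMul G X]
    (h4 : FourPoint X) {g : G} {x y p : X} (hx : g • x = x) (hy : g • y = y) (hp : MBtw x p y) :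
    g • p = p := by
  have hgp := hp.smul g
  rw [hx, hy] at hgp
  refine h4.eq_of_mbtw hgp hp ?_
  nth_rewrite 1 [← hx]
  exact dist_smul g x p

end Between

theorem HasTrivialArcStabilizers.eq_one {G : Type u} [Group G] {X : Type v} [MetricSpace X]
    [MulAction G X] [IsIsometricSMul G X] (hX : IsRTree X) (h : HasTrivialArcStabilizers G X)
    {g : G} {x y : X} (hne : x ≠ y) (hx : g • x = x) (hy : g • y = y) : g = 1 := by
  obtain ⟨S, hS, -⟩ := hX.existsUnique_segment x y
  have hmem : g ∈ fixingSubgroup G S := by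
    rw [mem_fixingSubgroup_iff]
    exact fun p hp => hX.fourPoint.fixes_of_mbtw hx hy (hS.mbtw hp)
  rw [h x y S hne hS] at hmem
  exact Subgroup.mem_bot.1 hmem

/-! ### Translation lengths and axes -/

section Axis

variable {G : Type u} [Group G] {X : Type v} [MetricSpace X] [MulAction G X] [IsIsometricSMul G X]

/-- `x` lies on the axis of `g`. If `g` fixes a point, then so does every point fixed by `g`. -/
def OnAxis (g : G) (x : X) : Prop := MBtw x (g • x) (g • g • x)

theorem OnAxis.inv {g : G} {x : X} (h : OnAxis g x) : OnAxis g⁻¹ x := by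
  have := (MBtw.smul h (g⁻¹ * g⁻¹)).symm
  simpa [OnAxis, mul_smul] using this

theorem onAxis_conj {g h : G} {x : X} : OnAxis (h * g * h⁻¹) x ↔ OnAxis g (h⁻¹ • x) := by
  constructor
  · intro H
    simpa [OnAxis, mul_smul] using MBtw.smul H h⁻¹
  · intro H
    simpa [OnAxis, mul_smul] using MBtw.smul H h

theorem OnAxis.dist_pow (h4 : FourPoint X) {g : G} {x : X} (h : OnAxis g x) (n : ℕ) :
    dist x (g ^ n • x) = n * dist x (g • x) := by
  by_cases hx : g • x = x
  · have : g ^ n • x = x := by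
      induction n with
      | zero => simp
      | succ n ih => rw [pow_succ, mul_smul, hx, ih]
    simp [this, hx]
  have key : ∀ n : ℕ, dist x (g ^ n • x) = n * dist x (g • x) ∧
      MBtw x (g ^ n • x) (g ^ (n + 1) • x) := by
    intro n
    induction n with
    | zero => simp [MBtw]
    | succ n ih =>
      have e : dist (g ^ n • x) (g ^ (n + 1) • x) = dist x (g • x) := by
        rw [pow_succ, mul_smul, dist_smul]
      have b := MBtw.smul h (g ^ n)
      simp only [smul_smul, ← mul_assoc, ← pow_succ] at b
      refine ⟨?_, (h4.concat ih.2 b ?_).2⟩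
      · have := ih.2
        unfold MBtw at this
        rw [← this, ih.1, e]
        push_cast
        ring
      · rw [pow_succ, mul_smul]
        exact fun H => hx (smul_left_cancel _ H).symm
  exact (key n).1

theorem dist_pow_smul_le (g : G) (y : X) (n : ℕ) : dist y (g ^ n • y) ≤ n * dist y (g • y) := by
  induction n with
  | zero => simp
  | succ n ih =>
    have e : dist (g ^ n • y) (g ^ (n + 1) • y) = dist y (g • y) := by
      rw [pow_succ, mul_smul, dist_smul]
    push_cast
    linarith [dist_triangle y (g ^ n • y) (g ^ (n + 1) • y)]

/-- The displacements of `x` and `y` under `g ^ n` differ by at most `2 * dist x y`, so their linear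
growth rates can be compared. -/
theorem OnAxis.dist_le (h4 : FourPoint X) {g : G} {x : X} (h : OnAxis g x) (y : X) :
    dist x (g • x) ≤ dist y (g • y) := by
  by_contra! hlt
  obtain ⟨n, hn⟩ := exists_nat_gt (2 * dist x y / (dist x (g • x) - dist y (g • y)))
  rw [div_lt_iff₀ (by linarith)] at hn
  have h1 := h.dist_pow h4 n
  have h2 := dist_pow_smul_le g y n
  have h3 := dist_triangle4 x y (g ^ n • y) (g ^ n • x)
  rw [dist_smul, dist_comm y x] at h3
  linarith

theorem OnAxis.translationLength_eq (h4 : FourPoint X) {g : G} {x : X} (h : OnAxis g x) :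
    translationLength X g = dist x (g • x) := by
  have : Nonempty X := ⟨x⟩
  refine le_antisymm (ciInf_le ⟨0, ?_⟩ x) (le_ciInf fun y => h.dist_le h4 y)
  rintro _ ⟨y, rfl⟩
  exact dist_nonneg

theorem OnAxis.dist_eq (h4 : FourPoint X) {g : G} {x y : X} (hx : OnAxis g x) (hy : OnAxis g y) :
    dist x (g • x) = dist y (g • y) :=
  le_antisymm (hx.dist_le h4 y) (hy.dist_le h4 x)

/-- The projection of a point to the axis of a fixed point free isometry. -/
theorem exists_projection (h4 : FourPoint X) (hb : HasBetweenPoints X) {g : G}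
    (hg : ∀ x : X, g • x ≠ x) (y : X) :
    ∃ p, OnAxis g p ∧ MBtw y p (g • p) ∧ MBtw y p (g⁻¹ • p) := by
  have hd : 0 < dist y (g • y) := dist_pos.2 (hg y).symm
  -- Otherwise `g` would fix the midpoint of `y` and `g • y`.
  have hlt : dist y (g • y) < dist y (g • g • y) := by
    by_contra! hle
    obtain ⟨m, m1, m2⟩ := hb y (g • y) (dist y (g • y) / 2) (by linarith) (by linarith)
    have m3 : dist (g • y) (g • m) = dist y (g • y) / 2 := by rw [dist_smul, m1]
    have m4 : dist (g • m) (g • g • y) = dist y (g • y) - dist y (g • y) / 2 := by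
      rw [dist_smul, m2]
    have e : dist (g • y) (g • g • y) = dist y (g • y) := dist_smul _ _ _
    have h1 : dist m (g • g • y) ≤ dist y (g • y) / 2 := by
      rcases h4.or m (g • g • y) y (g • y) with h | h <;>
        linarith [dist_comm m y, dist_comm (g • g • y) y, dist_comm (g • g • y) (g • y)]
    have h2 : dist m (g • m) ≤ 0 := by
      rcases h4.or m (g • m) (g • y) (g • g • y) with h | h <;>
        linarith [dist_comm (g • y) (g • m)]
    exact hg m (dist_le_zero.1 h2).symm
  have e : dist (g • y) (g • g • y) = dist y (g • y) := dist_smul _ _ _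
  have htr := dist_triangle y (g • y) (g • g • y)
  -- The Gromov product of `y` and `g • g • y` at `g • y`: the length of the backtracking there,
  -- which is the distance from `y` to the axis.
  obtain ⟨t, ht⟩ : ∃ t, t = (2 * dist y (g • y) - dist y (g • g • y)) / 2 := ⟨_, rfl⟩
  obtain ⟨p, p1, p2⟩ := hb y (g • y) t (by linarith) (by linarith)
  have q1 : dist (g • y) (g • p) = t := by rw [dist_smul, p1]
  have q2 : dist (g • p) (g • g • y) = dist y (g • y) - t := by rw [dist_smul, p2]
  have q3 : dist y (g • p) = dist y (g • y) - t := by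
    refine le_antisymm ?_ ?_
    · rcases h4.or y (g • p) (g • y) (g • g • y) with h | h <;>
        linarith [dist_comm (g • p) (g • y)]
    · linarith [dist_triangle y (g • p) (g • y), dist_comm (g • p) (g • y)]
  have q4 : dist p (g • p) = dist y (g • y) - 2 * t := by
    refine le_antisymm ?_ ?_
    · rcases h4.or p (g • p) y (g • y) with h | h <;>
        linarith [dist_comm p y, dist_comm (g • p) (g • y), dist_comm (g • p) y]
    · linarith [dist_triangle y p (g • p)]
  have q5 : dist (g • p) (g • g • p) = dist p (g • p) := dist_smul _ _ _
  have q6 : dist (g • g • p) (g • g • y) = t := by rw [dist_smul, dist_comm, q1]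
  refine ⟨p, ?_, ?_, ?_⟩
  · unfold OnAxis MBtw
    linarith [dist_triangle4 y p (g • g • p) (g • g • y), dist_triangle p (g • p) (g • g • p)]
  · unfold MBtw
    linarith
  · have : MBtw (g • y) (g • p) p := by
      unfold MBtw
      linarith [dist_comm p (g • y), dist_comm p (g • p)]
    simpa using this.smul g⁻¹

/-- A point of the axis which lies on the far side of `q` in both directions of the axis is `q`. -/
theorem OnAxis.eq_of_mbtw (h4 : FourPoint X) {g : G} {q y : X} (hg : g • q ≠ q)
    (hq : OnAxis g q) (hy : OnAxis g y) (h1 : MBtw y q (g • q)) (h2 : MBtw y q (g⁻¹ • q)) :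
    y = q := by
  have h3 : MBtw q (g • q) (g • y) := by simpa using (h2.smul g).symm
  have h5 := (h4.concat h1 h3 hg.symm).1
  have e := hq.dist_eq h4 hy
  have e2 : dist (g • q) (g • y) = dist q y := dist_smul _ _ _
  unfold MBtw at *
  exact dist_le_zero.1 (by linarith [dist_comm q y])

/-- The projection of `x` to the axis lies between `x` and every point of the axis. -/
theorem OnAxis.mbtw_of_projection (h4 : FourPoint X) {g : G} {x q y : X} (hg : g • q ≠ q)
    (hq : OnAxis g q) (hy : OnAxis g y) (h1 : MBtw x q (g • q)) (h2 : MBtw x q (g⁻¹ • q)) :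
    MBtw x q y := by
  by_contra hn
  have hlt : dist x y < dist x q + dist q y :=
    lt_of_le_of_ne (dist_triangle x q y) fun h => hn h.symm
  -- If `q` is not between `x` and `y`, then `y` leaves `q` in the direction of `x`, hence away from
  -- both directions of the axis.
  have aux : ∀ z, MBtw x q z → MBtw y q z := by
    intro z hz
    unfold MBtw at *
    refine le_antisymm ?_ (dist_triangle y q z)
    rcases h4.or x z y q with h | h
    · linarith [dist_comm z q, dist_comm y q]
    · linarith [dist_comm z y, dist_comm y q]
  obtain rfl := hq.eq_of_mbtw h4 hg hy (aux _ h1) (aux _ h2)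
  simp at hlt

/-- On its axis, an isometry or its inverse moves `y` away from `x`. -/
theorem OnAxis.mbtw_or_mbtw_inv (h4 : FourPoint X) {g : G} {x y : X}
    (hx : OnAxis g x) (hy : OnAxis g y) : MBtw x y (g • y) ∨ MBtw x y (g⁻¹ • y) := by
  have key : MBtw y x (g • x) ∨ MBtw y x (g⁻¹ • x) := by
    have h1 : MBtw (g⁻¹ • x) x (g • x) := by simpa using MBtw.smul hx g⁻¹
    unfold MBtw at *
    rcases h4.or (g⁻¹ • x) (g • x) x y with h | h
    · left
      linarith [dist_comm x y, dist_comm y (g • x), dist_triangle y x (g • x)]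
    · right
      linarith [dist_comm x y, dist_comm y (g⁻¹ • x), dist_triangle y x (g⁻¹ • x),
        dist_comm x (g⁻¹ • x), dist_comm x (g • x)]
  have e := hx.dist_eq h4 hy
  have e' := hx.inv.dist_eq h4 hy.inv
  rcases key with h | h
  · right
    have h' : MBtw (g⁻¹ • y) (g⁻¹ • x) x := by simpa using h.smul g⁻¹
    have e3 : dist (g⁻¹ • y) (g⁻¹ • x) = dist y x := dist_smul _ _ _
    unfold MBtw at *
    linarith [dist_comm x y, dist_comm x (g⁻¹ • y), dist_comm x (g⁻¹ • x)]
  · left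
    have h' : MBtw (g • y) (g • x) x := by simpa using h.smul g
    have e3 : dist (g • y) (g • x) = dist y x := dist_smul _ _ _
    unfold MBtw at *
    linarith [dist_comm x y, dist_comm x (g • y), dist_comm x (g • x)]

/-- If `g` moves `y` away from `x`, both on the axis, then `g` moves the points between `x` and `y`
away from `x` by the translation length. -/
theorem OnAxis.smul_mbtw (h4 : FourPoint X) {g : G} {x y w : X} (hx : OnAxis g x)
    (hy : OnAxis g y) (hxy : MBtw x y (g • y)) (hw : MBtw x w y) :
    MBtw x (g • w) (g • y) ∧ dist x (g • w) = dist x w + dist x (g • x) := by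
  have e := hx.dist_eq h4 hy
  have e1 : dist (g • x) (g • w) = dist x w := dist_smul _ _ _
  have e2 : dist (g • w) (g • y) = dist w y := dist_smul _ _ _
  unfold MBtw at *
  constructor <;> linarith [dist_triangle x (g • x) (g • w), dist_triangle x (g • w) (g • y)]

/-- If the axes of `a` and `c ^ 2 * a * (c ^ 2)⁻¹` meet, where `a` and `c` have the same translation
length, then `c` is `a` or its inverse. -/
theorem eq_or_eq_inv_of_onAxis (h4 : FourPoint X) (hb : HasBetweenPoints X)
    (harc : ∀ (g : G) (x y : X), x ≠ y → g • x = x → g • y = y → g = 1)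
    {a c : G} (hc : ∀ x : X, c • x ≠ x)
    (hac : ∀ x y : X, OnAxis a x → OnAxis c y → dist x (a • x) = dist y (c • y))
    {y : X} (hy : OnAxis a y) (hy' : OnAxis a (c • c • y)) : c = a ∨ c = a⁻¹ := by
  obtain ⟨z, hz, z1, z2⟩ := exists_projection h4 hb hc y
  have z2' : MBtw (c • y) (c • z) z := by simpa using z2.smul c
  have hne : z ≠ c • z := (hc z).symm
  have hne2 : c • z ≠ c • c • z := fun h => hne (smul_left_cancel c h)
  have z3 : MBtw (c • z) (c • c • z) (c • c • y) := (z2'.smul c).symm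
  -- the points `y, z, c z, c c z, c c y` are in order
  have b1 : MBtw y (c • z) (c • c • z) := (h4.concat z1 hz hne).2
  have b2 : MBtw y (c • c • z) (c • c • y) := (h4.concat b1 z3 hne2).2
  have b3 : MBtw y (c • z) (c • c • y) := b2.trans_left b1
  have b4 : MBtw y z (c • c • y) := b3.trans_left z1
  have hyz := hac y z hy hz
  have aux : ∀ g : G, OnAxis g y → OnAxis g (c • c • y) → dist y (g • y) = dist y (a • y) →
      MBtw y (c • c • y) (g • c • c • y) → c = g := by
    intro g g1 g2 hg hm
    -- On the segment from `y` to `c • c • y`, `g` and `c` translate forward by the same length. The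
    -- square of `c` makes room for this at both `z` and `c • z`, so `c⁻¹ * g` fixes an arc.
    have f : ∀ w, MBtw y w (c • c • y) → MBtw y w (c • w) → MBtw y (c • w) (c • c • y) →
        dist w (c • w) = dist z (c • z) → g • w = c • w := by
      intro w w1 w2 w3 w4
      obtain ⟨k1, k2⟩ := g1.smul_mbtw h4 g2 hm w1
      refine h4.eq_of_mbtw k1 (hm.trans_left w3) ?_
      unfold MBtw at w2
      linarith
    have f1 := f z b4 z1 b3 rfl
    have f2 := f (c • z) b3 b1 b2 (dist_smul c _ _)
    have := harc (c⁻¹ * g) z (c • z) hne (by rw [mul_smul, f1, inv_smul_smul])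
      (by rw [mul_smul, f2, inv_smul_smul])
    exact inv_mul_eq_one.1 this
  rcases hy.mbtw_or_mbtw_inv h4 hy' with h | h
  · exact Or.inl (aux a hy hy' rfl h)
  · refine Or.inr (aux a⁻¹ hy.inv hy'.inv ?_ h)
    have : dist (a • y) (a • a⁻¹ • y) = dist y (a⁻¹ • y) := dist_smul _ _ _
    rw [smul_inv_smul] at this
    rw [← this, dist_comm]

end Axis

/-! ### Translation lengths of products -/

section Product

variable {G : Type u} [Group G] {X : Type v} [MetricSpace X] [MulAction G X] [IsIsometricSMul G X]

/-- The translation length of a product of two isometries that fix different points. -/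
theorem translationLength_mul_of_fixed (h4 : FourPoint X) (hb : HasBetweenPoints X)
    (harc : ∀ (g : G) (x y : X), x ≠ y → g • x = x → g • y = y → g = 1)
    {u v : G} {p q : X} (hu : u ≠ 1) (hv : v ≠ 1) (hp : u • p = p) (hq : v • q = q) :
    translationLength X (u * v) = 2 * dist p q := by
  by_cases hpq : p = q
  · subst hpq
    have h : (u * v) • p = p := by rw [mul_smul, hq, hp]
    rw [OnAxis.translationLength_eq (g := u * v) (x := p) h4 (by simp [OnAxis, MBtw, h]), h]
    simp
  -- Otherwise the segments from `y` to `x` and to `w • x` share an initial arc, of length the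
  -- Gromov product `s`, which `w` fixes.
  have aux : ∀ (w : G) (x y : X), w ≠ 1 → w • y = y → MBtw x y (w • x) := by
    intro w x y hw hy
    by_contra hn
    have e1 : dist y (w • x) = dist y x := by
      nth_rewrite 1 [← hy]
      exact dist_smul w y x
    have hlt : dist x (w • x) < 2 * dist y x :=
      lt_of_le_of_ne (by linarith [dist_triangle x y (w • x), dist_comm x y]) fun h => hn (by
        unfold MBtw
        linarith [dist_comm x y])
    have h0 : 0 ≤ dist x (w • x) := dist_nonneg
    obtain ⟨s, hs⟩ : ∃ s, s = (2 * dist y x - dist x (w • x)) / 2 := ⟨_, rfl⟩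
    obtain ⟨m, m1, m2⟩ := hb y x s (by linarith) (by linarith)
    have k1 : dist y (w • m) = s := by
      rw [← m1]
      nth_rewrite 1 [← hy]
      exact dist_smul w y m
    have k2 : dist (w • m) (w • x) = dist y x - s := by rw [dist_smul, m2]
    have k3 : dist m (w • x) ≤ dist y x - s := by
      rcases h4.or m (w • x) x y with h | h <;>
        linarith [dist_comm m y, dist_comm (w • x) y, dist_comm (w • x) x, dist_comm x y]
    have k4 : dist m (w • m) ≤ 0 := by
      rcases h4.or m (w • m) y (w • x) with h | h <;>
        linarith [dist_comm m y, dist_comm (w • m) y]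
    have hmy : m ≠ y := by
      rintro rfl
      rw [dist_self] at m1
      linarith
    exact hw (harc w m y hmy (dist_le_zero.1 k4).symm hy)
  -- The path `p, u q, u v p, u v u q, u v u v p` is geodesic, so `p` lies on the axis of `u * v`.
  have hpuq : p ≠ u • q := fun h => hpq (smul_left_cancel u (hp.trans h))
  have c1 : MBtw p (u • q) ((u * v) • p) := by
    simpa [mul_smul, hp] using (aux v p q hv hq).smul u
  have c3 := c1.smul (u * v)
  have c2 : MBtw (u • q) ((u * v) • p) ((u * v) • u • q) := by
    simpa [mul_smul, hq] using (aux u q p hu hp).smul (u * v)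
  have hne : (u * v) • p ≠ (u * v) • u • q := fun h => hpuq (smul_left_cancel _ h)
  have hne' : u • q ≠ (u * v) • p := by
    rw [mul_smul]
    intro h
    have := smul_left_cancel u h
    exact hpq (smul_left_cancel v (this.symm.trans hq.symm))
  have d1 := (h4.concat c1 c2 hne').2
  have d2 := (h4.concat d1 c3 hne).1
  rw [OnAxis.translationLength_eq h4 d2, ← c1]
  have e1 : dist p (u • q) = dist p q := by
    nth_rewrite 1 [← hp]
    exact dist_smul u p q
  have e2 : dist (u • q) ((u * v) • p) = dist p q := by
    rw [mul_smul, dist_smul, dist_comm p q]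
    nth_rewrite 1 [← hq]
    exact dist_smul v q p
  rw [e1, e2]
  ring

/-- The translation length of a product of two isometries that translate along disjoint axes,
joined by the segment from `p` to `q`. -/
theorem translationLength_mul_of_mbtw (h4 : FourPoint X) {u v : G} {p q : X} (hpq : p ≠ q)
    (hu : u • p ≠ p) (hv : v • q ≠ q) (hu1 : MBtw q p (u • p)) (hu2 : MBtw q p (u⁻¹ • p))
    (hv1 : MBtw p q (v • q)) (hv2 : MBtw p q (v⁻¹ • q)) :
    translationLength X (u * v) = dist p (u • p) + dist q (v • q) + 2 * dist p q := by
  have c1 : MBtw p (u • p) (u • q) := by simpa using (hu2.smul u).symm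
  have c2 : MBtw (u • p) (u • q) ((u * v) • q) := by simpa [mul_smul] using hv1.smul u
  have c3 : MBtw (u • q) ((u * v) • q) ((u * v) • p) := by
    simpa [mul_smul] using (hv2.smul (u * v)).symm
  have c4 : MBtw ((u * v) • q) ((u * v) • p) ((u * v) • u • p) := hu1.smul (u * v)
  have n1 : u • p ≠ u • q := fun h => hpq (smul_left_cancel u h)
  have n2 : (u * v) • q ≠ (u * v) • p := fun h => hpq (smul_left_cancel _ h).symm
  have n3 : u • p ≠ (u * v) • q := by
    intro h
    have h0 := dist_pos.2 n1
    unfold MBtw at c2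
    rw [← h, dist_self] at c2
    linarith [dist_nonneg (x := u • q) (y := u • p)]
  -- distances along the path `p, u p, u q, u v q, u v p`
  have n4 : u • q ≠ (u * v) • q := by
    rw [mul_smul]
    exact fun h => hv (smul_left_cancel u h).symm
  have n5 : (u * v) • p ≠ (u * v) • u • p := fun h => hu (smul_left_cancel _ h).symm
  have c13 := (h4.concat c1 c2 n1).1
  have c134 := (h4.concat c2 c3 n4).2
  have c014 := h4.concat c13 c134 n3
  have c045 := (h4.concat c014.2 c4 n2).2
  rw [OnAxis.translationLength_eq h4 (h4.concat c045 (c014.1.smul (u * v)) n5).1]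
  have e1 : dist (u • p) (u • q) = dist p q := dist_smul _ _ _
  have e2 : dist (u • q) ((u * v) • q) = dist q (v • q) := by rw [mul_smul, dist_smul]
  have e3 : dist ((u * v) • q) ((u * v) • p) = dist q p := dist_smul _ _ _
  have c014' := c014.1
  unfold MBtw at *
  linarith [dist_comm p q]

theorem OnAxis.pow_mbtw (h4 : FourPoint X) {g : G} {x p : X} (hg : g • p ≠ p) (hp : OnAxis g p)
    (h : MBtw x p (g • p)) (n : ℕ) : MBtw x p (g ^ n • p) := by
  cases n with
  | zero => simp [MBtw]
  | succ n =>
    refine (h4.concat h ?_ hg.symm).1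
    have e : dist (g • p) (g ^ (n + 1) • p) = dist p (g ^ n • p) := by
      rw [pow_succ', mul_smul, dist_smul]
    unfold MBtw
    rw [e, hp.dist_pow h4, hp.dist_pow h4]
    push_cast
    ring

theorem OnAxis.zpow_mbtw (h4 : FourPoint X) {g : G} {x p : X} (hg : g • p ≠ p) (hp : OnAxis g p)
    (h1 : MBtw x p (g • p)) (h2 : MBtw x p (g⁻¹ • p)) (n : ℤ) : MBtw x p (g ^ n • p) := by
  obtain ⟨m, rfl | rfl⟩ := n.eq_nat_or_neg
  · simpa using hp.pow_mbtw h4 hg h1 m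
  · have hg' : g⁻¹ • p ≠ p := fun h => hg (inv_smul_eq_iff.1 h).symm
    simpa using hp.inv.pow_mbtw h4 hg' h2 m

theorem OnAxis.dist_zpow (h4 : FourPoint X) {g : G} {p : X} (hp : OnAxis g p) (n : ℤ) :
    dist p (g ^ n • p) = |(n : ℝ)| * dist p (g • p) := by
  obtain ⟨m, rfl | rfl⟩ := n.eq_nat_or_neg
  · simpa using hp.dist_pow h4 m
  · have e : dist p (g⁻¹ • p) = dist p (g • p) := by
      rw [← dist_smul g p (g⁻¹ • p), smul_inv_smul, dist_comm]
    have := hp.inv.dist_pow h4 m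
    rw [e] at this
    simpa using this

theorem OnAxis.zpow_smul_ne (h4 : FourPoint X) {g : G} {p : X} (hg : g • p ≠ p) (hp : OnAxis g p)
    {n : ℤ} (hn : n ≠ 0) : g ^ n • p ≠ p := by
  intro h
  have := hp.dist_zpow h4 n
  rw [h, dist_self, zero_eq_mul] at this
  rcases this with h' | h'
  · exact hn (by simpa using h')
  · exact hg (dist_eq_zero.1 h').symm

/-- The translation length of the product of powers of `a` and of a conjugate of `a` whose axis is
disjoint from that of `a` depends linearly on the absolute values of the exponents. -/
theorem exists_translationLength_mul_conj (hX : IsRTree X) (ht : HasTrivialArcStabilizers G X)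
    {a b : G} (h1 : b * a * b⁻¹ ≠ a) (h2 : b * a * b⁻¹ ≠ a⁻¹) :
    ∃ l D : ℝ, ∀ p r : ℤ, a ^ p ≠ 1 → a ^ r ≠ 1 →
      translationLength X (a ^ p * (b * a ^ 2 * b⁻¹ * a ^ r * (b * a ^ 2 * b⁻¹)⁻¹)) =
        (|(p : ℝ)| + |(r : ℝ)|) * l + D := by
  have h4 := hX.fourPoint
  have hb := hX.hasBetweenPoints
  have harc : ∀ (g : G) (x y : X), x ≠ y → g • x = x → g • y = y → g = 1 :=
    fun g x y => ht.eq_one hX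
  obtain ⟨h, hh⟩ : ∃ h, h = b * a ^ 2 * b⁻¹ := ⟨_, rfl⟩
  rw [← hh]
  by_cases ha : ∃ x : X, a • x = x
  · obtain ⟨x, hx⟩ := ha
    have hxn : ∀ n : ℤ, a ^ n • x = x := fun n =>
      MulAction.mem_stabilizer_iff.1 (zpow_mem (MulAction.mem_stabilizer_iff.2 hx) n)
    -- Elliptic case: the factors fix `x` and `h • x`, independently of the exponents.
    refine ⟨0, 2 * dist x (h • x), fun p r hp hr => ?_⟩
    rw [translationLength_mul_of_fixed h4 hb harc hp (v := h * a ^ r * h⁻¹) ?_ (hxn p)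
      (q := h • x) (by simp [mul_smul, hxn])]
    · ring
    · simpa using hr
  push Not at ha
  obtain ⟨c, hc⟩ : ∃ c, c = b * a * b⁻¹ := ⟨_, rfl⟩
  have hhc : h = c * c := by rw [hh, hc, ← conj_pow, sq]
  obtain ⟨d, hd⟩ : ∃ d, d = h * a * h⁻¹ := ⟨_, rfl⟩
  have conj_free : ∀ (k : G) (x : X), (k * a * k⁻¹) • x ≠ x := by
    intro k x hx
    refine ha (k⁻¹ • x) (smul_left_cancel k ?_)
    rwa [smul_inv_smul, ← mul_smul, ← mul_smul]
  have hcx : ∀ x : X, c • x ≠ x := hc ▸ conj_free b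
  have hdx : ∀ x : X, d • x ≠ x := hd ▸ conj_free h
  have hac : ∀ x y : X, OnAxis a x → OnAxis c y → dist x (a • x) = dist y (c • y) := by
    intro x y hx hy
    rw [hc, onAxis_conj] at hy
    rw [hx.dist_eq h4 hy, ← dist_smul b (b⁻¹ • y), hc]
    simp [mul_smul]
  -- A common point `x` puts both `h⁻¹ • x` and its image under `c * c = h` on the axis of `a`.
  have hdisj : ∀ x : X, OnAxis a x → ¬ OnAxis d x := by
    intro x hx hx'
    rw [hd, onAxis_conj] at hx'
    have e : c • c • h⁻¹ • x = x := by rw [← mul_smul, ← hhc, smul_inv_smul]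
    rcases eq_or_eq_inv_of_onAxis h4 hb harc hcx hac hx' (e.symm ▸ hx) with k | k
    · exact h1 (hc ▸ k)
    · exact h2 (hc ▸ k)
  obtain ⟨o⟩ := hX.nonempty
  -- Projecting a point of the axis of `d` to that of `a` and back gives the bridge from `p` to `q`.
  -- As `q` lies between `p` and `y`, `p` is also the projection of `q`.
  obtain ⟨y, hy, -, -⟩ := exists_projection h4 hb hdx o
  obtain ⟨p, hp, p1, p2⟩ := exists_projection h4 hb ha y
  obtain ⟨q, hq, q1, q2⟩ := exists_projection h4 hb hdx p
  have hpq : p ≠ q := by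
    rintro rfl
    exact hdisj p hp hq
  have hpqy := hq.mbtw_of_projection h4 (hdx q) hy q1 q2
  have p1' : MBtw q p (a • p) := p1.right_of_left hpqy.symm
  have p2' : MBtw q p (a⁻¹ • p) := p2.right_of_left hpqy.symm
  have had : dist q (d • q) = dist p (a • p) := by
    rw [hd, onAxis_conj] at hq
    rw [hp.dist_eq h4 hq, ← dist_smul h (h⁻¹ • q), hd]
    simp [mul_smul]
  refine ⟨dist p (a • p), 2 * dist p q, fun n r hn hr => ?_⟩
  have hn0 : n ≠ 0 := by
    rintro rfl
    simp at hn
  have hr0 : r ≠ 0 := by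
    rintro rfl
    simp at hr
  have e : h * a ^ r * h⁻¹ = d ^ r := by rw [hd, conj_zpow]
  rw [e, translationLength_mul_of_mbtw h4 hpq (hp.zpow_smul_ne h4 (ha p) hn0)
    (hq.zpow_smul_ne h4 (hdx q) hr0) (hp.zpow_mbtw h4 (ha p) p1' p2' n)
    (by simpa using hp.zpow_mbtw h4 (ha p) p1' p2' (-n)) (hq.zpow_mbtw h4 (hdx q) q1 q2 r)
    (by simpa using hq.zpow_mbtw h4 (hdx q) q1 q2 (-r)), hp.dist_zpow h4, hq.dist_zpow h4, had]
  ring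

end Product

/-! ### Elements with equal translation lengths -/

section Group

variable {G : Type u} [Group G]

/-- The product of `a ^ p` with a certain conjugate of `a ^ r`. -/
def twistedPower (a b : G) (p r : ℤ) : G :=
  a ^ p * (b * a ^ 2 * b⁻¹ * a ^ r * (b * a ^ 2 * b⁻¹)⁻¹)

theorem abelianization_of_twistedPower (a b : G) (p r : ℤ) :
    Abelianization.of (twistedPower a b p r) = Abelianization.of a ^ (p + r) := by
  simp only [twistedPower, map_mul, map_inv, map_zpow, mul_inv_cancel_comm, zpow_add]

theorem equalTranslationLengths_twistedPower {a b : G} (hab : a * b ≠ b * a)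
    (ha : Abelianization.of a ^ 2 ≠ 1) {p r p' r' : ℤ} (hp : a ^ p ≠ 1) (hr : a ^ r ≠ 1)
    (hp' : a ^ p' ≠ 1) (hr' : a ^ r' ≠ 1) (h : |p| + |r| = |p'| + |r'|) :
    EqualTranslationLengths.{u, v} (twistedPower a b p r) (twistedPower a b p' r') := by
  intro X _ _ _ hX ht
  have h1 : b * a * b⁻¹ ≠ a := fun e => hab (mul_inv_eq_iff_eq_mul.1 e).symm
  have h2 : b * a * b⁻¹ ≠ a⁻¹ := by
    intro e
    have := congrArg Abelianization.of e
    simp only [map_mul, map_inv, mul_inv_cancel_comm] at this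
    exact ha (by rw [sq]; exact mul_eq_one_iff_eq_inv.2 this)
  obtain ⟨l, D, hlD⟩ := exists_translationLength_mul_conj hX ht h1 h2
  have h' : |(p : ℝ)| + |(r : ℝ)| = |(p' : ℝ)| + |(r' : ℝ)| := by exact_mod_cast h
  rw [twistedPower, twistedPower, hlD p r hp hr, hlD p' r' hp' hr', h']

theorem abelianization_of_eq_of_isConj {g h : G} (H : IsConj g h) :
    Abelianization.of g = Abelianization.of h :=
  isConj_iff_eq.1 (Abelianization.of.map_isConj H)

/-- If every `x * a ^ k` had trivial cube or fourth power, the two cases would alternate in `k`,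
because `a ^ 3` and `a ^ 4` are nontrivial. Comparing terms two apart gives `a ^ 6 = a ^ 8 = 1`, so
`a ^ 2 = 1`, a contradiction. -/
theorem exists_mul_pow_pow_ne_one {A : Type u} [CommGroup A] (x : A) {a : A} (h3 : a ^ 3 ≠ 1)
    (h4 : a ^ 4 ≠ 1) : ∃ k : ℕ, (x * a ^ k) ^ 3 ≠ 1 ∧ (x * a ^ k) ^ 4 ≠ 1 := by
  have step : ∀ k m n : ℕ, (x * a ^ k) ^ n = 1 → (x * a ^ (k + m)) ^ n = 1 → a ^ (m * n) = 1 := by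
    intro k m n e1 e2
    rw [pow_add, ← mul_assoc, mul_pow, e1, one_mul] at e2
    rw [pow_mul, e2]
  by_contra! H
  have hor : ∀ k, (x * a ^ k) ^ 3 = 1 ∨ (x * a ^ k) ^ 4 = 1 :=
    fun k => or_iff_not_imp_left.2 (H k)
  have s3 : ∀ k, (x * a ^ k) ^ 3 = 1 → (x * a ^ (k + 1)) ^ 3 ≠ 1 :=
    fun k e1 e2 => h3 (by simpa using step k 1 3 e1 e2)
  have s4 : ∀ k, (x * a ^ k) ^ 4 = 1 → (x * a ^ (k + 1)) ^ 4 ≠ 1 :=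
    fun k e1 e2 => h4 (by simpa using step k 1 4 e1 e2)
  have f3 : ∀ k, (x * a ^ k) ^ 3 = 1 → (x * a ^ (k + 1)) ^ 4 = 1 :=
    fun k e => (hor (k + 1)).resolve_left (s3 k e)
  have f4 : ∀ k, (x * a ^ k) ^ 4 = 1 → (x * a ^ (k + 1)) ^ 3 = 1 :=
    fun k e => (hor (k + 1)).resolve_right (s4 k e)
  obtain ⟨k, hk⟩ : ∃ k, (x * a ^ k) ^ 3 = 1 := by
    rcases hor 0 with e | e
    · exact ⟨0, e⟩
    · exact ⟨1, f4 0 e⟩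
  have a6 := step k 2 3 hk (f4 _ (f3 _ hk))
  have a8 := step (k + 1) 2 4 (f3 _ hk) (f3 _ (f4 _ (f3 _ hk)))
  have a2 : a ^ 2 = 1 := by
    have : a ^ (2 * 4) = a ^ (2 * 3) * a ^ 2 := by rw [← pow_add]
    rwa [a6, a8, one_mul, eq_comm] at this
  exact h4 (by rw [show 4 = 2 * 2 from rfl, pow_mul, a2, one_pow])

/-- A nonabelian group contains a noncentral element whose image in the abelianization has third
and fourth power different from `1`, if some element of the abelianization has this property. -/
theorem exists_noncentral_of_pow_ne_one (hG : ∃ a b : G, a * b ≠ b * a) {α : Abelianization G}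
    (h3 : α ^ 3 ≠ 1) (h4 : α ^ 4 ≠ 1) :
    ∃ a b : G, a * b ≠ b * a ∧ Abelianization.of a ^ 3 ≠ 1 ∧ Abelianization.of a ^ 4 ≠ 1 := by
  obtain ⟨a, rfl⟩ : ∃ a, Abelianization.of a = α := Quotient.exists_rep α
  by_cases hc : ∃ b, a * b ≠ b * a
  · obtain ⟨b, hb⟩ := hc
    exact ⟨a, b, hb, h3, h4⟩
  push Not at hc
  obtain ⟨x, b, hxb⟩ := hG
  have hnc : ∀ k : ℕ, x * a ^ k * b ≠ b * (x * a ^ k) := by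
    intro k e
    have hk : a ^ k * b = b * a ^ k := (Commute.pow_left (hc b) k).eq
    rw [mul_assoc, hk, ← mul_assoc, ← mul_assoc] at e
    exact hxb (mul_right_cancel e)
  obtain ⟨k, k3, k4⟩ := exists_mul_pow_pow_ne_one (Abelianization.of x) h3 h4
  refine ⟨x * a ^ k, b, hnc k, ?_, ?_⟩
  · rwa [map_mul, map_pow]
  · rwa [map_mul, map_pow]

/-- A central lift `a` is replaced by a noncentral `x`, or by `x * a` when `x` has finite order in
the abelianization. -/
theorem exists_noncentral_of_not_isOfFinOrder (hG : ∃ a b : G, a * b ≠ b * a)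
    {α : Abelianization G} (hα : ¬ IsOfFinOrder α) :
    ∃ a b : G, a * b ≠ b * a ∧ ¬ IsOfFinOrder (Abelianization.of a) := by
  obtain ⟨a, rfl⟩ : ∃ a, Abelianization.of a = α := Quotient.exists_rep α
  by_cases hc : ∃ b, a * b ≠ b * a
  · obtain ⟨b, hb⟩ := hc
    exact ⟨a, b, hb, hα⟩
  push Not at hc
  obtain ⟨x, b, hxb⟩ := hG
  by_cases hx : IsOfFinOrder (Abelianization.of x)
  · refine ⟨x * a, b, fun e => hxb ?_, fun h => hα ?_⟩
    · rw [mul_assoc, hc b, ← mul_assoc, ← mul_assoc] at e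
      exact mul_right_cancel e
    · have := (Commute.all _ _).isOfFinOrder_mul hx.inv h
      simpa using this
  · exact ⟨x, b, hxb, hx⟩

end Group

theorem corollary4p5 (G : Type u) [Group G] (hG : ∃ a b : G, a * b ≠ b * a) :
    ((∃ a : Abelianization G, ¬ IsOfFinOrder a) →
      ∀ M : ℕ, 1 ≤ M → ∃ g : Fin M → G,
        (∀ i, g i ≠ 1) ∧
        (∀ i j, i ≠ j → ¬ IsConj (g i) (g j) ∧ ¬ IsConj (g i) (g j)⁻¹) ∧
        ∀ i j, EqualTranslationLengths.{u, v} (g i) (g j)) ∧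
    ((∃ a : Abelianization G, ¬ IsOfFinOrder a ∨ 4 < orderOf a) →
      ∃ g₁ g₂ : G, g₁ ≠ 1 ∧ g₂ ≠ 1 ∧
        ¬ IsConj g₁ g₂ ∧ ¬ IsConj g₁ g₂⁻¹ ∧
        EqualTranslationLengths.{u, v} g₁ g₂) := by
  constructor
  · rintro ⟨α, hα⟩ M -
    obtain ⟨a, b, hab, ha⟩ := exists_noncentral_of_not_isOfFinOrder hG hα
    have hinj : ∀ m n : ℤ, Abelianization.of a ^ m = Abelianization.of a ^ n → m = n :=
      fun m n h => injective_zpow_iff_not_isOfFinOrder.2 ha h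
    have hpow : ∀ n : ℤ, n ≠ 0 → a ^ n ≠ 1 := by
      intro n hn h
      refine hn (hinj n 0 ?_)
      rw [← map_zpow, h, map_one, zpow_zero]
    -- The absolute values sum to `2 * M + 1` for every `i`, while the exponents sum to `2 * i + 1`:
    -- distinct positive integers, so never zero, equal or opposite.
    refine ⟨fun i => twistedPower a b (M + 1 + (i : ℕ)) (-(M - (i : ℕ))), ?_, ?_, ?_⟩
    · intro i h
      have := congrArg Abelianization.of h
      rw [abelianization_of_twistedPower, map_one, ← zpow_zero (Abelianization.of a)] at this
      have := hinj _ _ this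
      omega
    · intro i j hij
      have hne : (i : ℕ) ≠ j := fun h => hij (Fin.ext h)
      constructor <;> intro h
      · have := abelianization_of_eq_of_isConj h
        rw [abelianization_of_twistedPower, abelianization_of_twistedPower] at this
        have := hinj _ _ this
        omega
      · have := abelianization_of_eq_of_isConj h
        rw [map_inv, abelianization_of_twistedPower, abelianization_of_twistedPower,
          ← zpow_neg] at this
        have := hinj _ _ this
        omega
    · intro i j
      have hi := i.isLt
      have hj := j.isLt
      refine equalTranslationLengths_twistedPower hab ?_ (hpow _ (by omega)) (hpow _ (by omega))
        (hpow _ (by omega)) (hpow _ (by omega)) ?_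
      · intro h
        have := hinj 2 0 (by simpa using h)
        omega
      · rw [abs_of_nonneg (by omega), abs_of_nonpos (by omega), abs_of_nonneg (by omega),
          abs_of_nonpos (by omega)]
        ring
  · rintro ⟨α, hα⟩
    have hα' : ∀ n, 0 < n → n ≤ 4 → α ^ n ≠ 1 := by
      intro n hn hn4 h
      rcases hα with hα | hα
      · exact hα (isOfFinOrder_iff_pow_eq_one.2 ⟨n, hn, h⟩)
      · have := orderOf_le_of_pow_eq_one hn h
        omega
    obtain ⟨a, b, hab, h3, h4⟩ := exists_noncentral_of_pow_ne_one hG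
      (hα' 3 (by norm_num) (by norm_num)) (hα' 4 (by norm_num) (by norm_num))
    have h2 : Abelianization.of a ^ 2 ≠ 1 := fun h => h4 (by
      rw [show 4 = 2 * 2 from rfl, pow_mul, h, one_pow])
    have h1 : Abelianization.of a ≠ 1 := fun h => h2 (by rw [h, one_pow])
    have k1 : a ≠ 1 := fun h => h1 (by rw [h, map_one])
    have k2 : a ^ 2 ≠ 1 := fun h => h2 (by rw [← map_pow, h, map_one])
    have e1 : Abelianization.of (twistedPower a b 2 1) = Abelianization.of a ^ 3 := by
      rw [abelianization_of_twistedPower]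
      exact zpow_natCast _ 3
    have e2 : Abelianization.of (twistedPower a b 2 (-1)) = Abelianization.of a := by
      rw [abelianization_of_twistedPower]
      simp
    -- In the abelianization these become `a ^ 3` and `a`; they are nontrivial, and neither equal
    -- nor inverse, exactly when the powers 1 to 4 of `a` are nontrivial there.
    refine ⟨twistedPower a b 2 1, twistedPower a b 2 (-1), fun h => h3 ?_, fun h => h1 ?_,
      fun h => h2 ?_, fun h => h4 ?_, ?_⟩
    · rw [← e1, h, map_one]
    · rw [← e2, h, map_one]
    · have := abelianization_of_eq_of_isConj h
      rw [e1, e2, pow_succ] at this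
      exact mul_eq_right.1 this
    · have := abelianization_of_eq_of_isConj h
      rw [map_inv, e1, e2] at this
      rw [pow_succ, this, inv_mul_cancel]
    · refine equalTranslationLengths_twistedPower hab h2 ?_ ?_ ?_ ?_ ?_
      · exact_mod_cast k2
      · simpa using k1
      · exact_mod_cast k2
      · simpa using k1
      · simp
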